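/- Let $C\subset\mathbb R^2$ be an $o$-symmetric plane convex body, i.e. a compact convex set with non-empty interior and $C=-C$. Let $\|\cdot\|_C$ be the norm with unit disk $C$. The $C$-length of a polygonal curve is the sum of the $\|\cdot\|_C$-distances between consecutive vertices, and the $C$-length of a curve is the supremum of the $C$-lengths of the polygonal curves whose vertices are chosen, in order, from the curve. Let $\operatorname{perim}_C(C)$ be the $C$-length of the boundary $\partial C$. For points $p,q\in\mathbb R^2$ with $\|p-q\|_C\le 2$, let the arc-distance $\operatorname{arclength}_C(p,q)$ be the minimum of the $C$-lengths of the arcs with endpoints $p$ and $q$ that are contained in $\partial(y+C)$ for some $y\in\mathbb R^2$ (a single point counts as an arc from $p$ to $p$, so that $\operatorname{arclength}_C(p,p)=0$). Then for every real $\rho$ with $0\le\rho\le\frac12\operatorname{perim}_C(C)$, the arc-distance disk $$\Delta_C(\rho)=\{w\in\mathbb R^2:\ \|w\|_C\le 2,\ \operatorname{arclength}_C(o,w)\le\rho\}$$ is convex. -/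

import Mathlib

open Set
open scoped ENNReal Pointwise

noncomputable section

/-- The Euclidean plane. -/
abbrev Plane := EuclideanSpace ℝ (Fin 2)

/-- The `C`-distance of two points, i.e. the distance in the norm with unit disk `C`
(for an `o`-symmetric plane convex body `C`). -/
def cDist (C : Set Plane) (p q : Plane) : ℝ := gauge C (q - p)

/-- The `C`-length of the curve `γ : [a, b] → ℝ²`: the supremum of the `C`-lengths of the
polygonal curves whose vertices are chosen, in order, from the curve. -/
def cLength (C : Set Plane) (γ : ℝ → Plane) (a b : ℝ) : ℝ≥0∞ :=
  ⨆ (n : ℕ) (t : ℕ → ℝ) (_ : Monotone t) (_ : ∀ i, t i ∈ Icc a b),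
    ∑ i ∈ Finset.range n, ENNReal.ofReal (cDist C (γ (t i)) (γ (t (i + 1))))

/-- `γ`, restricted to `[a, b]`, is a simple closed curve whose trace is `S`. -/
structure IsSimpleClosedCurve (γ : ℝ → Plane) (a b : ℝ) (S : Set Plane) : Prop where
  lt : a < b
  continuousOn : ContinuousOn γ (Icc a b)
  injOn : InjOn γ (Ico a b)
  closed : γ a = γ b
  image_eq : γ '' Icc a b = S

/-- The perimeter of `D` with respect to `C`: the `C`-length of the boundary of `D`.
All simple closed parametrizations of the boundary of a plane convex body have the same length,
so that the infimum over the parametrizations is their common value. -/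
def perim (C D : Set Plane) : ℝ≥0∞ :=
  ⨅ (γ : ℝ → Plane) (a : ℝ) (b : ℝ) (_ : IsSimpleClosedCurve γ a b (frontier D)),
    cLength C γ a b

/-- `γ`, restricted to `[a, b]`, parametrizes an arc (an injective continuous image of a compact
interval, which may degenerate to a point) with endpoints `p` and `q` that is contained in `S`. -/
structure IsArcIn (S : Set Plane) (γ : ℝ → Plane) (a b : ℝ) (p q : Plane) : Prop where
  le : a ≤ b
  continuousOn : ContinuousOn γ (Icc a b)
  injOn : InjOn γ (Icc a b)
  source : γ a = p
  target : γ b = q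
  mapsTo : MapsTo γ (Icc a b) S

/-- The arc-distance of `p` and `q` with respect to `C`: the least `C`-length of an arc with
endpoints `p` and `q` that is contained in the boundary of some translate `y + C`.
It is `⊤` if there is no such arc. -/
def arcDist (C : Set Plane) (p q : Plane) : ℝ≥0∞ :=
  ⨅ (y : Plane) (γ : ℝ → Plane) (a : ℝ) (b : ℝ) (_ : IsArcIn (frontier (y +ᵥ C)) γ a b p q),
    cLength C γ a b

/-- The arc-distance disk with respect to `C` of center `z` and radius `ρ`; arc-distance is
defined for points at `C`-distance at most two. -/
def arcDisk (C : Set Plane) (z : Plane) (ρ : ℝ) : Set Plane :=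
  {w | cDist C z w ≤ 2 ∧ arcDist C z w ≤ ENNReal.ofReal ρ}

end

/-!
Give the plane the norm with unit disk `C`. An arc from `z` to `w` in the boundary of a translate of
`C` is a translate of an arc of the unit circle with displacement `w - z`; reversing the orientation
amounts to a rotation by `π`, since `C = -C`. Up to translation the arc-distance disk is therefore
the closed set `A` of the displacements of the counterclockwise arcs of length at most `ρ`.

Let `u θ` be the point of the unit circle in direction `θ`. If `‖w‖ < 2` and `w ∉ A`, write
`w = u β - u α` with `α < β < α + π`. There is a linear functional `f` such that `f (u θ)` minus the
arc length up to `θ` increases from `α` to `β` and decreases on the rest of the circle. Hence the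
arc from `α` to `β` maximizes the value of `f` at the displacement minus the length among all arcs.
As it is longer than `ρ`, this gives `f v < f w` for all `v ∈ A`, so `w` is not in the convex hull
of `A`. A point `w` of the hull with `‖w‖ = 2` is the limit of the points `τ • w` of the hull with
`τ < 1`, which lie in `A`.
-/

section UnitCircle

variable {E : Type*} [NormedAddCommGroup E] [NormedSpace ℝ E]

theorem norm_normalize_sub_normalize_le {x : E} (hx : x ≠ 0) (y : E) :
    ‖NormedSpace.normalize x - NormedSpace.normalize y‖ ≤ 2 * (‖x‖⁻¹ * ‖x - y‖) := by
  have hy : ‖NormedSpace.normalize y‖ ≤ 1 := by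
    by_cases hy : y = 0
    · simp [hy]
    · exact (NormedSpace.norm_normalize hy).le
  have hsplit : NormedSpace.normalize x - NormedSpace.normalize y
      = ‖x‖⁻¹ • ((x - y) + (‖y‖ - ‖x‖) • NormedSpace.normalize y) := by
    rw [sub_smul, NormedSpace.norm_smul_normalize, sub_add_sub_cancel, smul_sub, smul_smul,
      inv_mul_cancel₀ (norm_ne_zero_iff.2 hx), one_smul, NormedSpace.normalize]
  calc ‖NormedSpace.normalize x - NormedSpace.normalize y‖
      ≤ ‖x‖⁻¹ * (‖x - y‖ + |‖y‖ - ‖x‖| * ‖NormedSpace.normalize y‖) := by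
        rw [hsplit, norm_smul, norm_inv, norm_norm, ← Real.norm_eq_abs, ← norm_smul]
        gcongr
        exact norm_add_le _ _
    _ ≤ ‖x‖⁻¹ * (‖x - y‖ + ‖x - y‖ * 1) := by
        gcongr
        rw [norm_sub_rev x y]
        exact abs_norm_sub_norm_le y x
    _ = 2 * (‖x‖⁻¹ * ‖x - y‖) := by ring

theorem normalize_map_normalize {F G : Type*} [NormedAddCommGroup F] [NormedSpace ℝ F]
    [FunLike G E F] [LinearMapClass G ℝ E F] (f : G) (x : E) :
    NormedSpace.normalize (f (NormedSpace.normalize x)) = NormedSpace.normalize (f x) := by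
  rcases eq_or_ne x 0 with rfl | hx
  · simp
  · have hscale : NormedSpace.normalize x = ‖x‖⁻¹ • x := rfl
    rw [hscale, map_smul, NormedSpace.normalize_smul_of_pos (inv_pos.2 (norm_pos_iff.2 hx))]

variable (Φ : E ≃L[ℝ] ℂ)

/-- The vector of `E` whose image under the coordinate isomorphism `Φ` is `exp (i θ)`. -/
noncomputable def ray (θ : ℝ) : E := Φ.symm (Circle.exp θ)

/-- The point of the unit circle of `E` in direction `θ`. This parametrizes the unit circle
counterclockwise with respect to the coordinates `Φ`, with period `2 π`. -/
noncomputable def unitPoint (θ : ℝ) : E := NormedSpace.normalize (ray Φ θ)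

theorem apply_ray (θ : ℝ) : Φ (ray Φ θ) = Circle.exp θ := Φ.apply_symm_apply _

theorem ray_ne_zero (θ : ℝ) : ray Φ θ ≠ 0 := by
  simp [ray]

theorem norm_unitPoint (θ : ℝ) : ‖unitPoint Φ θ‖ = 1 :=
  NormedSpace.norm_normalize (ray_ne_zero Φ θ)

theorem unitPoint_add_pi (θ : ℝ) : unitPoint Φ (θ + Real.pi) = -unitPoint Φ θ := by
  have hray : ray Φ (θ + Real.pi) = -ray Φ θ := by simp [ray]
  rw [unitPoint, unitPoint, hray, NormedSpace.normalize_neg]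

theorem unitPoint_sub_pi (θ : ℝ) : unitPoint Φ (θ - Real.pi) = -unitPoint Φ θ := by
  rw [← neg_eq_iff_eq_neg, ← unitPoint_add_pi, sub_add_cancel]

theorem unitPoint_periodic : Function.Periodic (unitPoint Φ) (2 * Real.pi) := fun θ ↦ by
  rw [two_mul, ← add_assoc, unitPoint_add_pi, unitPoint_add_pi, neg_neg]

theorem unitPoint_eq_iff {z : E} (hz : ‖z‖ = 1) {θ : ℝ} :
    unitPoint Φ θ = z ↔ (Circle.exp θ : ℂ) = NormedSpace.normalize (Φ z) := by
  constructor
  · rintro rfl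
    rw [unitPoint, normalize_map_normalize, apply_ray,
      NormedSpace.normalize_eq_self_of_norm_eq_one (Circle.norm_coe _)]
  · intro h
    rw [unitPoint, ray, h, normalize_map_normalize, Φ.symm_apply_apply,
      NormedSpace.normalize_eq_self_of_norm_eq_one hz]

theorem exists_unitPoint_eq {z : E} (hz : ‖z‖ = 1) (a : ℝ) :
    ∃ θ ∈ Ioc (a - Real.pi) (a + Real.pi), unitPoint Φ θ = z := by
  obtain ⟨θ, hθ, h⟩ := (unitPoint_periodic Φ).exists_mem_Ioc Real.two_pi_pos
    (Complex.arg (Φ z)) (a - Real.pi)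
  refine ⟨θ, ⟨hθ.1, by linarith [hθ.2]⟩, ?_⟩
  have hΦz : Φ z ≠ 0 := by simpa using norm_ne_zero_iff.1 (hz.trans_ne one_ne_zero)
  rw [← h, unitPoint_eq_iff Φ hz, Circle.coe_exp, NormedSpace.normalize, Complex.real_smul,
    Complex.ofReal_inv, eq_inv_mul_iff_mul_eq₀ (Complex.ofReal_ne_zero.2 (norm_ne_zero_iff.2 hΦz)),
    Complex.norm_mul_exp_arg_mul_I]

theorem exists_eq_norm_smul_unitPoint (z : E) (a : ℝ) :
    ∃ θ ∈ Ioc (a - Real.pi) (a + Real.pi), z = ‖z‖ • unitPoint Φ θ := by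
  rcases eq_or_ne z 0 with rfl | hz
  · exact ⟨a, ⟨by linarith [Real.pi_pos], by linarith [Real.pi_pos]⟩, by simp⟩
  · obtain ⟨θ, hθ, h⟩ := exists_unitPoint_eq Φ (NormedSpace.norm_normalize hz) a
    exact ⟨θ, hθ, by rw [h, NormedSpace.norm_smul_normalize]⟩

theorem injOn_unitPoint {x y : ℝ} (h : y < x + 2 * Real.pi) :
    InjOn (unitPoint Φ) (Icc x y) := fun s hs t ht hst ↦ by
  have hexp : (Circle.exp s : ℂ) = Circle.exp t := by
    rw [(unitPoint_eq_iff Φ (norm_unitPoint Φ s)).1 rfl,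
      (unitPoint_eq_iff Φ (norm_unitPoint Φ s)).1 hst.symm]
  exact Circle.exp_injOn_Icc (by linarith) hs ht (Circle.ext hexp)

theorem inv_norm_ray_le (θ : ℝ) : ‖ray Φ θ‖⁻¹ ≤ ‖(Φ : E →L[ℝ] ℂ)‖ := by
  have h := (Φ : E →L[ℝ] ℂ).le_opNorm (ray Φ θ)
  rw [ContinuousLinearEquiv.coe_coe, apply_ray, Circle.norm_coe] at h
  exact (inv_le_iff_one_le_mul₀ (norm_pos_iff.2 (ray_ne_zero Φ θ))).2 h

theorem exists_lipschitzWith_unitPoint : ∃ K, LipschitzWith K (unitPoint Φ) := by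
  refine ⟨_, LipschitzWith.of_dist_le_mul (K := 2 * (‖(Φ : E →L[ℝ] ℂ)‖₊ *
    ‖(Φ.symm : ℂ →L[ℝ] E)‖₊)) fun x y ↦ ?_⟩
  have hcircle : ‖(Circle.exp x : ℂ) - Circle.exp y‖ ≤ |x - y| := by
    simpa [circleMap, dist_eq_norm] using (lipschitzWith_circleMap 0 1).dist_le_mul x y
  have hray : ‖ray Φ x - ray Φ y‖ ≤ ‖(Φ.symm : ℂ →L[ℝ] E)‖ * |x - y| := by
    rw [ray, ray, ← map_sub]
    exact (Φ.symm : ℂ →L[ℝ] E).le_opNorm_of_le hcircle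
  calc dist (unitPoint Φ x) (unitPoint Φ y)
      ≤ 2 * (‖ray Φ x‖⁻¹ * ‖ray Φ x - ray Φ y‖) := by
        rw [dist_eq_norm]
        exact norm_normalize_sub_normalize_le (ray_ne_zero Φ x) _
    _ ≤ 2 * (‖(Φ : E →L[ℝ] ℂ)‖ * (‖(Φ.symm : ℂ →L[ℝ] E)‖ * |x - y|)) := by
        gcongr
        exact inv_norm_ray_le Φ x
    _ = _ := by
        push_cast
        rw [Real.dist_eq]
        ring

theorem continuous_unitPoint : Continuous (unitPoint Φ) :=
  (exists_lipschitzWith_unitPoint Φ).choose_spec.continuous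

theorem sin_smul_ray (a x y : ℝ) :
    Real.sin (y - a) • ray Φ x = Real.sin (y - x) • ray Φ a + Real.sin (x - a) • ray Φ y := by
  simp only [ray, ← map_smul, ← map_add]
  congr 1
  apply Complex.ext <;>
    simp only [Circle.coe_exp, Complex.smul_re, Complex.smul_im, Complex.add_re, Complex.add_im,
      smul_eq_mul, Complex.exp_ofReal_mul_I_re, Complex.exp_ofReal_mul_I_im, Real.sin_sub] <;>
    ring

theorem unitPoint_eq_smul_add_smul {a x y : ℝ} (hay : a < y) (hya : y < a + Real.pi) :
    unitPoint Φ x =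
      (Real.sin (y - x) * ‖ray Φ a‖ / (Real.sin (y - a) * ‖ray Φ x‖)) • unitPoint Φ a +
      (Real.sin (x - a) * ‖ray Φ y‖ / (Real.sin (y - a) * ‖ray Φ x‖)) • unitPoint Φ y := by
  have hsin : Real.sin (y - a) ≠ 0 := (Real.sin_pos_of_pos_of_lt_pi (by linarith) (by linarith)).ne'
  have hx := norm_ne_zero_iff.2 (ray_ne_zero Φ x)
  apply smul_right_injective E (mul_ne_zero hsin hx)
  simp only [smul_add, smul_smul, mul_div_cancel₀ _ (mul_ne_zero hsin hx)]
  simp only [mul_smul, unitPoint, NormedSpace.norm_smul_normalize, sin_smul_ray Φ a x y]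

theorem exists_unitPoint_eq_smul_add_smul {a x y : ℝ} (hax : a ≤ x) (hxy : x ≤ y) (hay : a < y)
    (hya : y < a + Real.pi) :
    ∃ s t : ℝ, 0 ≤ s ∧ 0 ≤ t ∧ unitPoint Φ x = s • unitPoint Φ a + t • unitPoint Φ y := by
  have sin_nonneg {θ : ℝ} (h0 : 0 ≤ θ) (hπ : θ < Real.pi) : 0 ≤ Real.sin θ :=
    Real.sin_nonneg_of_nonneg_of_le_pi h0 hπ.le
  have := sin_nonneg (θ := y - x) (by linarith) (by linarith)
  have := sin_nonneg (θ := x - a) (by linarith) (by linarith)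
  have := sin_nonneg (θ := y - a) (by linarith) (by linarith)
  exact ⟨_, _, by positivity, by positivity, unitPoint_eq_smul_add_smul Φ hay hya⟩

theorem exists_eq_smul_unitPoint_add_smul_unitPoint {a y : ℝ} (hay : a < y) (hya : y < a + Real.pi)
    (z : E) : ∃ s t : ℝ, z = s • unitPoint Φ a + t • unitPoint Φ y := by
  obtain ⟨θ, -, hz⟩ := exists_eq_norm_smul_unitPoint Φ z 0
  rw [unitPoint_eq_smul_add_smul Φ hay hya, smul_add, smul_smul, smul_smul] at hz
  exact ⟨_, _, hz⟩

end UnitCircle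

section ArcLength

theorem eVariationOn_Icc_le_of_dist_le {α M : Type*} [LinearOrder α] [PseudoMetricSpace M]
    {c : α → M} {g : α → ℝ} {x y : α} (hxy : x ≤ y)
    (h : ∀ s ∈ Icc x y, ∀ t ∈ Icc x y, s ≤ t → dist (c s) (c t) ≤ g t - g s) :
    eVariationOn c (Icc x y) ≤ ENNReal.ofReal (g y - g x) := by
  have hg : MonotoneOn g (Icc x y) := fun s hs t ht hst ↦
    sub_nonneg.1 (dist_nonneg.trans (h s hs t ht hst))
  have hg_var : eVariationOn g (Icc x y) = ENNReal.ofReal (g y - g x) := by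
    rw [← hg.eVariationOn_eq (left_mem_Icc.2 hxy) (right_mem_Icc.2 hxy), inter_self]
  rw [← hg_var]
  refine iSup_le fun p ↦ (Finset.sum_le_sum fun i _ ↦ ?_).trans
    (eVariationOn.sum_le p.2.2.1 p.2.2.2)
  rw [edist_comm (c _), edist_comm (g _), edist_dist, edist_dist]
  gcongr
  rw [dist_comm (g _), Real.dist_eq]
  exact (h _ (p.2.2.2 _) _ (p.2.2.2 _) (p.2.2.1 i.le_succ)).trans (le_abs_self _)

theorem lipschitzWith_variationOnFromTo {M : Type*} [PseudoMetricSpace M] {c : ℝ → M} {K : NNReal}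
    (hc : LipschitzWith K c) (a : ℝ) : LipschitzWith K (variationOnFromTo c univ a) := by
  have hbv := hc.locallyBoundedVariationOn univ
  refine LipschitzWith.of_le_add_mul K fun y x ↦ ?_
  rw [← sub_le_iff_le_add', ← variationOnFromTo.add hbv (mem_univ a) (mem_univ x) (mem_univ y),
    add_sub_cancel_left]
  rcases le_total x y with hxy | hyx
  · rw [variationOnFromTo.eq_of_le _ _ hxy, univ_inter, Real.dist_eq, abs_of_nonneg (by linarith),
      mul_sub]
    refine ENNReal.toReal_le_of_le_ofReal (by nlinarith [K.coe_nonneg])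
      (eVariationOn_Icc_le_of_dist_le (g := fun t ↦ K * t) hxy fun s _ t _ hst ↦ ?_)
    rw [← mul_sub, ← abs_of_nonneg (sub_nonneg.2 hst), ← Real.dist_eq, dist_comm t]
    exact hc.dist_le_mul s t
  · exact (variationOnFromTo.nonpos_of_ge _ _ hyx).trans (by positivity)

variable {E : Type*} [NormedAddCommGroup E] [NormedSpace ℝ E] (Φ : E ≃L[ℝ] ℂ)

/-- The signed length of the arc of the unit circle of `E` from direction `x` to direction `y`,
negative if `y < x`. -/
noncomputable def arcLength (x y : ℝ) : ℝ := variationOnFromTo (unitPoint Φ) univ x y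

theorem locallyBoundedVariationOn_unitPoint :
    LocallyBoundedVariationOn (unitPoint Φ) univ :=
  (exists_lipschitzWith_unitPoint Φ).choose_spec.locallyBoundedVariationOn univ

theorem arcLength_self (x : ℝ) : arcLength Φ x x = 0 := variationOnFromTo.self _ _ _

theorem arcLength_add (x y z : ℝ) : arcLength Φ x y + arcLength Φ y z = arcLength Φ x z :=
  variationOnFromTo.add (locallyBoundedVariationOn_unitPoint Φ) (mem_univ x) (mem_univ y)
    (mem_univ z)

theorem arcLength_nonneg {x y : ℝ} (h : x ≤ y) : 0 ≤ arcLength Φ x y :=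
  variationOnFromTo.nonneg_of_le _ _ h

theorem ofReal_arcLength {x y : ℝ} (h : x ≤ y) :
    ENNReal.ofReal (arcLength Φ x y) = eVariationOn (unitPoint Φ) (Icc x y) := by
  have hbv := locallyBoundedVariationOn_unitPoint Φ x y (mem_univ x) (mem_univ y)
  rw [arcLength, variationOnFromTo.eq_of_le _ _ h, ENNReal.ofReal_toReal hbv, univ_inter]

theorem arcLength_le_of_norm_sub_le {g : ℝ → ℝ} {x y : ℝ} (hxy : x ≤ y)
    (h : ∀ s ∈ Icc x y, ∀ t ∈ Icc x y, s ≤ t →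
      ‖unitPoint Φ t - unitPoint Φ s‖ ≤ g t - g s) :
    arcLength Φ x y ≤ g y - g x := by
  have hg : 0 ≤ g y - g x :=
    (norm_nonneg _).trans (h x (left_mem_Icc.2 hxy) y (right_mem_Icc.2 hxy) hxy)
  rw [← ENNReal.ofReal_le_ofReal_iff hg, ofReal_arcLength Φ hxy]
  exact eVariationOn_Icc_le_of_dist_le hxy fun s hs t ht hst ↦ by
    rw [dist_comm, dist_eq_norm]
    exact h s hs t ht hst

theorem norm_unitPoint_sub_le_arcLength {x y : ℝ} (h : x ≤ y) :
    ‖unitPoint Φ y - unitPoint Φ x‖ ≤ arcLength Φ x y := by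
  rw [← ENNReal.ofReal_le_ofReal_iff (arcLength_nonneg Φ h), ofReal_arcLength Φ h,
    ← dist_eq_norm, ← edist_dist]
  exact eVariationOn.edist_le _ (right_mem_Icc.2 h) (left_mem_Icc.2 h)

theorem arcLength_add_pi (x y : ℝ) :
    arcLength Φ (x + Real.pi) (y + Real.pi) = arcLength Φ x y := by
  have hshift : unitPoint Φ ∘ (· + Real.pi) = -unitPoint Φ := funext (unitPoint_add_pi Φ)
  have hmono : MonotoneOn (fun t : ℝ ↦ t + Real.pi) univ :=
    (add_left_strictMono.monotone).monotoneOn _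
  have h := variationOnFromTo.comp_eq_of_monotoneOn (unitPoint Φ) _ hmono
    (mem_univ x) (mem_univ y)
  rw [hshift, image_univ, (add_right_surjective _).range_eq] at h
  rw [arcLength, arcLength, ← h]
  simp only [variationOnFromTo, eVariationOn, Pi.neg_apply, edist_neg_neg]

theorem arcLength_add_two_pi (x y : ℝ) :
    arcLength Φ (x + 2 * Real.pi) (y + 2 * Real.pi) = arcLength Φ x y := by
  rw [two_mul, ← add_assoc, ← add_assoc, arcLength_add_pi, arcLength_add_pi]

theorem continuous_arcLength : Continuous fun p : ℝ × ℝ ↦ arcLength Φ p.1 p.2 := by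
  have h0 : Continuous (arcLength Φ 0) :=
    (lipschitzWith_variationOnFromTo (exists_lipschitzWith_unitPoint Φ).choose_spec 0).continuous
  have hsub (p : ℝ × ℝ) : arcLength Φ p.1 p.2 = arcLength Φ 0 p.2 - arcLength Φ 0 p.1 := by
    rw [eq_sub_iff_add_eq', arcLength_add]
  simp only [hsub]
  exact (h0.comp continuous_snd).sub (h0.comp continuous_fst)

end ArcLength

section Support

variable {E : Type*} [NormedAddCommGroup E] [NormedSpace ℝ E]

theorem abs_apply_le_norm {h : StrongDual ℝ E} (hh : ‖h‖ ≤ 1) (z : E) : |h z| ≤ ‖z‖ := by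
  simpa using h.le_of_opNorm_le hh z

theorem apply_le_apply_of_eq_smul_add_smul {h : StrongDual ℝ E} (hh : ‖h‖ ≤ 1) {a x y : E}
    (ha : ‖a‖ = 1) (hx : ‖x‖ = 1) (hy : ‖y‖ = 1) (hha : h a = 1) {s t : ℝ} (hs : 0 ≤ s)
    (ht : 0 ≤ t) (hxay : x = s • a + t • y) : h y ≤ h x := by
  have hst : |1 - t| ≤ s := by
    have hrev := abs_norm_sub_norm_le x (t • y)
    rwa [sub_eq_of_eq_add hxay, norm_smul, norm_smul, ha, hx, hy, mul_one, mul_one,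
      Real.norm_of_nonneg hs, Real.norm_of_nonneg ht] at hrev
  have hhy : |h y| ≤ 1 := hy ▸ abs_apply_le_norm hh y
  have hbound : (1 - t) * h y ≤ s := calc
    (1 - t) * h y ≤ |1 - t| * |h y| := (le_abs_self _).trans_eq (abs_mul _ _)
    _ ≤ s * 1 := by gcongr
    _ = s := mul_one s
  have hhx : h x = s + t * h y := by simp [hxay, hha]
  linarith

variable (Φ : E ≃L[ℝ] ℂ)

theorem antitoneOn_apply_unitPoint {h : StrongDual ℝ E} (hh : ‖h‖ ≤ 1) {a : ℝ}
    (ha : h (unitPoint Φ a) = 1) :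
    AntitoneOn (fun θ ↦ h (unitPoint Φ θ)) (Icc a (a + Real.pi)) := by
  intro x hx y hy hxy
  rcases hy.1.eq_or_lt with rfl | hay
  · rw [le_antisymm hxy hx.1]
  rcases hy.2.eq_or_lt with rfl | hya
  · have := neg_le_of_abs_le (abs_apply_le_norm hh (unitPoint Φ x))
    rw [norm_unitPoint] at this
    simpa only [unitPoint_add_pi, map_neg, ha] using this
  obtain ⟨s, t, hs, ht, hst⟩ := exists_unitPoint_eq_smul_add_smul Φ hx.1 hxy hay hya
  exact apply_le_apply_of_eq_smul_add_smul hh (norm_unitPoint Φ a) (norm_unitPoint Φ x)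
    (norm_unitPoint Φ y) ha hs ht hst

theorem monotoneOn_apply_unitPoint {h : StrongDual ℝ E} (hh : ‖h‖ ≤ 1) {a : ℝ}
    (ha : h (unitPoint Φ a) = 1) :
    MonotoneOn (fun θ ↦ h (unitPoint Φ θ)) (Icc (a - Real.pi) a) := by
  intro x hx y hy hxy
  have hneg : h (unitPoint Φ (y + Real.pi)) ≤ h (unitPoint Φ (x + Real.pi)) :=
    antitoneOn_apply_unitPoint Φ hh ha ⟨by linarith [hx.1], by linarith [hx.2]⟩
      ⟨by linarith [hy.1], by linarith [hy.2]⟩ (by linarith)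
  simpa only [unitPoint_add_pi, map_neg, neg_le_neg_iff] using hneg

end Support

section Chord

variable {E : Type*} [NormedAddCommGroup E] [NormedSpace ℝ E] (Φ : E ≃L[ℝ] ℂ)

theorem exists_norm_unitPoint_add_eq_one {w : E} (hw : ‖w‖ ≤ 2) :
    ∃ α, ‖unitPoint Φ α + w‖ = 1 := by
  obtain ⟨φ, -, hφ⟩ := exists_eq_norm_smul_unitPoint Φ w 0
  have hcont : ContinuousOn (fun θ ↦ ‖unitPoint Φ θ + w‖) (Icc (φ - Real.pi) φ) :=
    ((continuous_unitPoint Φ).add continuous_const).norm.continuousOn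
  have hleft : ‖unitPoint Φ (φ - Real.pi) + w‖ ≤ 1 := by
    have : unitPoint Φ (φ - Real.pi) + w = (‖w‖ - 1) • unitPoint Φ φ := by
      rw [unitPoint_sub_pi, sub_smul, one_smul, ← hφ, neg_add_eq_sub]
    rw [this, norm_smul, norm_unitPoint, mul_one, Real.norm_eq_abs, abs_le]
    constructor <;> linarith [norm_nonneg w]
  have hright : 1 ≤ ‖unitPoint Φ φ + w‖ := by
    have : unitPoint Φ φ + w = (1 + ‖w‖) • unitPoint Φ φ := by
      rw [add_smul, one_smul, ← hφ]
    rw [this, norm_smul, norm_unitPoint, mul_one, Real.norm_of_nonneg (by positivity)]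
    exact le_add_of_nonneg_right (norm_nonneg w)
  obtain ⟨α, -, hα⟩ :=
    intermediate_value_Icc (by linarith [Real.pi_pos]) hcont ⟨hleft, hright⟩
  exact ⟨α, hα⟩

theorem norm_unitPoint_add_pi_sub (θ : ℝ) :
    ‖unitPoint Φ (θ + Real.pi) - unitPoint Φ θ‖ = 2 := by
  rw [unitPoint_add_pi, ← neg_add', norm_neg, ← two_smul ℝ, norm_smul, norm_unitPoint]
  norm_num

theorem exists_unitPoint_sub_unitPoint_eq {w : E} (hw0 : w ≠ 0) (hw2 : ‖w‖ < 2) :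
    ∃ α β, α < β ∧ β < α + Real.pi ∧ unitPoint Φ β - unitPoint Φ α = w := by
  obtain ⟨α, hα⟩ := exists_norm_unitPoint_add_eq_one Φ hw2.le
  obtain ⟨β, ⟨hαβ, hβα⟩, hβ⟩ := exists_unitPoint_eq Φ hα α
  obtain rfl : unitPoint Φ β - unitPoint Φ α = w := sub_eq_of_eq_add' hβ
  have hβ_ne : β ≠ α + Real.pi := by
    rintro rfl
    exact hw2.ne (norm_unitPoint_add_pi_sub Φ α)
  rcases lt_trichotomy α β with h | rfl | h
  · exact ⟨α, β, h, hβα.lt_of_ne hβ_ne, rfl⟩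
  · exact absurd (sub_self _) hw0
  · refine ⟨β + Real.pi, α + Real.pi, by linarith, by linarith, ?_⟩
    rw [unitPoint_add_pi, unitPoint_add_pi, neg_sub_neg]

end Chord

section Calibration

variable {E : Type*} [NormedAddCommGroup E] [NormedSpace ℝ E]

theorem norm_smul_add_smul_le {s t : ℝ} (hs : 0 ≤ s) (ht : 0 ≤ t) (d e : E) :
    ‖s • d + t • e‖ ≤ s * ‖d‖ + t * ‖e‖ := by
  simpa only [norm_smul, Real.norm_of_nonneg hs, Real.norm_of_nonneg ht]
    using norm_add_le (s • d) (t • e)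

theorem mul_norm_add_mul_norm_le {s : ℝ} (hs : s ≤ 0) (t : ℝ) (d e : E) :
    s * ‖d‖ + t * ‖e‖ ≤ ‖s • d + t • e‖ := by
  have h : ‖t • e‖ - ‖s • d‖ ≤ ‖s • d + t • e‖ := by
    simpa only [add_comm, norm_neg, sub_neg_eq_add] using norm_sub_norm_le (t • e) (-(s • d))
  rw [norm_smul, norm_smul, Real.norm_of_nonpos hs] at h
  have ht : t * ‖e‖ ≤ ‖t‖ * ‖e‖ := by
    gcongr
    exact le_abs_self t
  linarith

variable (Φ : E ≃L[ℝ] ℂ) {α β : ℝ}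

/-- The excess of a functional `f` over arc length, measured from direction `0`: its increment
from `x` to `y` is the value of `f` at the displacement of the arc from `x` to `y` minus the length
of that arc. -/
noncomputable def excess (f : StrongDual ℝ E) (θ : ℝ) : ℝ := f (unitPoint Φ θ) - arcLength Φ 0 θ

/-- A functional calibrates the arc from `α` to `β` of the unit circle if its excess over arc length
grows along that arc and decays along the complementary arc. -/
structure IsCalibration (f : StrongDual ℝ E) (α β : ℝ) : Prop where
  monotoneOn : MonotoneOn (excess Φ f) (Icc α β)
  antitoneOn : AntitoneOn (excess Φ f) (Icc β (α + 2 * Real.pi))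

theorem excess_sub_excess (f : StrongDual ℝ E) (x y : ℝ) :
    excess Φ f y - excess Φ f x = f (unitPoint Φ y - unitPoint Φ x) - arcLength Φ x y := by
  rw [excess, excess, map_sub, ← arcLength_add Φ 0 x y]
  ring

theorem monotoneOn_excess {f : StrongDual ℝ E} (h : ∀ x ∈ Icc α β, ∀ y ∈ Icc α β, x ≤ y →
    ‖unitPoint Φ y - unitPoint Φ x‖ ≤ f (unitPoint Φ y - unitPoint Φ x)) :
    MonotoneOn (excess Φ f) (Icc α β) := fun x hx y hy hxy ↦ by
  rw [← sub_nonneg, excess_sub_excess, sub_nonneg, map_sub]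
  refine arcLength_le_of_norm_sub_le Φ (g := fun t ↦ f (unitPoint Φ t)) hxy
    fun s hs t ht hst ↦ ?_
  rw [← map_sub]
  exact h s (Icc_subset_Icc hx.1 hy.2 hs) t (Icc_subset_Icc hx.1 hy.2 ht) hst

theorem antitoneOn_excess {f : StrongDual ℝ E} (h : ∀ x ∈ Icc α β, ∀ y ∈ Icc α β, x ≤ y →
    f (unitPoint Φ y - unitPoint Φ x) ≤ ‖unitPoint Φ y - unitPoint Φ x‖) :
    AntitoneOn (excess Φ f) (Icc α β) := fun x hx y hy hxy ↦ by
  rw [← sub_nonpos, excess_sub_excess, sub_nonpos]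
  exact (h x hx y hy hxy).trans (norm_unitPoint_sub_le_arcLength Φ hxy)

-- Displacements have nonnegative coordinates along the arc, and a nonpositive one elsewhere: the
-- triangle inequality bounds `‖s • d + t • e‖` by `s * ‖d‖ + t * ‖e‖` from above in the first case,
-- from below in the second.
theorem isCalibration_of_coordinates (hαβ : α ≤ β) (hβα : β ≤ α + Real.pi)
    {a b : StrongDual ℝ E} {d e : E} (hcoord : ∀ z, a z • d + b z • e = z)
    (ha_mono : MonotoneOn (fun θ ↦ a (unitPoint Φ θ)) (Icc α β))
    (ha_anti : AntitoneOn (fun θ ↦ a (unitPoint Φ θ)) (Icc β (α + Real.pi)))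
    (hb_mono : MonotoneOn (fun θ ↦ b (unitPoint Φ θ)) (Icc α β))
    (hb_anti : AntitoneOn (fun θ ↦ b (unitPoint Φ θ)) (Icc (α + Real.pi) (α + 2 * Real.pi))) :
    IsCalibration Φ (‖d‖ • a + ‖e‖ • b) α β := by
  have happly (z : E) : (‖d‖ • a + ‖e‖ • b) z = a z * ‖d‖ + b z * ‖e‖ := by simp [mul_comm]
  constructor
  · refine monotoneOn_excess Φ fun x hx y hy hxy ↦ ?_
    rw [happly]
    nth_rw 1 [← hcoord (_ - _)]
    refine norm_smul_add_smul_le ?_ ?_ d e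
    · simpa only [map_sub, sub_nonneg] using ha_mono hx hy hxy
    · simpa only [map_sub, sub_nonneg] using hb_mono hx hy hxy
  · have hanti_left : AntitoneOn (excess Φ (‖d‖ • a + ‖e‖ • b)) (Icc β (α + Real.pi)) := by
      refine antitoneOn_excess Φ fun x hx y hy hxy ↦ ?_
      rw [happly]
      nth_rw 3 [← hcoord (_ - _)]
      refine mul_norm_add_mul_norm_le ?_ _ d e
      simpa only [map_sub, sub_nonpos] using ha_anti hx hy hxy
    have hanti_right :
        AntitoneOn (excess Φ (‖d‖ • a + ‖e‖ • b)) (Icc (α + Real.pi) (α + 2 * Real.pi)) := by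
      refine antitoneOn_excess Φ fun x hx y hy hxy ↦ ?_
      rw [happly, add_comm]
      nth_rw 3 [← hcoord (_ - _)]
      rw [add_comm (_ • d)]
      refine mul_norm_add_mul_norm_le ?_ _ e d
      simpa only [map_sub, sub_nonpos] using hb_anti hx hy hxy
    have hπ : α + Real.pi ≤ α + 2 * Real.pi := by linarith [Real.pi_pos]
    rw [← Icc_union_Icc_eq_Icc hβα hπ]
    exact hanti_left.union_right hanti_right (isGreatest_Icc hβα) (isLeast_Icc hπ)

theorem exists_isCalibration_of_mul_lt_one (hαβ : α < β) (hβα : β < α + Real.pi)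
    {h₁ h₂ : StrongDual ℝ E} (hh₁ : ‖h₁‖ ≤ 1) (hh₂ : ‖h₂‖ ≤ 1) (hα : h₁ (unitPoint Φ α) = 1)
    (hβ : h₂ (unitPoint Φ β) = 1) (hlt : h₁ (unitPoint Φ β) * h₂ (unitPoint Φ α) < 1) :
    ∃ f, IsCalibration Φ f α β := by
  set u := unitPoint Φ α
  set v := unitPoint Φ β
  set p := h₁ v
  set q := h₂ u
  set k := (1 - p * q)⁻¹
  have hk : 0 ≤ k := inv_nonneg.2 (by linarith)
  have hk_mul : k * (1 - p * q) = 1 := inv_mul_cancel₀ (by linarith)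
  have hcoord (z : E) : (k • h₂) z • (v - p • u) + (-(k • h₁)) z • (q • v - u) = z := by
    obtain ⟨s, t, rfl⟩ := exists_eq_smul_unitPoint_add_smul_unitPoint Φ hαβ hβα z
    have h₁z : h₁ (s • u + t • v) = s + t * p := by simp [hα, p]
    have h₂z : h₂ (s • u + t • v) = s * q + t := by simp [hβ, q]
    change (k * h₂ (s • u + t • v)) • (v - p • u) + (-(k * h₁ (s • u + t • v))) • (q • v - u) = _
    rw [h₁z, h₂z]
    linear_combination (norm := module) hk_mul • (s • u + t • v)
  have ha_mono := monotoneOn_apply_unitPoint Φ hh₂ hβ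
  have ha_anti := antitoneOn_apply_unitPoint Φ hh₂ hβ
  have hb_anti := antitoneOn_apply_unitPoint Φ hh₁ hα
  have hb_mono := monotoneOn_apply_unitPoint Φ hh₁ (a := α + 2 * Real.pi)
    (by rw [unitPoint_periodic, hα])
  refine ⟨_, isCalibration_of_coordinates Φ hαβ.le hβα.le hcoord ?_ ?_ ?_ ?_⟩
  · exact fun x hx y hy hxy ↦ mul_le_mul_of_nonneg_left
      (ha_mono ⟨by linarith [hx.1], hx.2⟩ ⟨by linarith [hy.1], hy.2⟩ hxy) hk
  · exact fun x hx y hy hxy ↦ mul_le_mul_of_nonneg_left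
      (ha_anti ⟨hx.1, by linarith [hx.2]⟩ ⟨hy.1, by linarith [hy.2]⟩ hxy) hk
  · exact fun x hx y hy hxy ↦ neg_le_neg (mul_le_mul_of_nonneg_left
      (hb_anti ⟨hx.1, by linarith [hx.2]⟩ ⟨hy.1, by linarith [hy.2]⟩ hxy) hk)
  · exact fun x hx y hy hxy ↦ neg_le_neg (mul_le_mul_of_nonneg_left
      (hb_mono ⟨by linarith [hx.1], hx.2⟩ ⟨by linarith [hy.1], hy.2⟩ hxy) hk)

-- If a supporting line touches the circle at both ends of the arc, then the arc is a segment.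
theorem exists_isCalibration_of_apply_eq_one (hαβ : α < β) (hβα : β < α + Real.pi)
    {h : StrongDual ℝ E} (hh : ‖h‖ ≤ 1) (hα : h (unitPoint Φ α) = 1)
    (hβ : h (unitPoint Φ β) = 1) : ∃ f, IsCalibration Φ f α β := by
  obtain ⟨f, hf, hfw⟩ := exists_dual_vector'' ℝ (unitPoint Φ β - unitPoint Φ α)
  have harc {x : ℝ} (hx : x ∈ Icc α β) : h (unitPoint Φ x) = 1 := by
    refine le_antisymm ((le_abs_self _).trans ((abs_apply_le_norm hh _).trans_eq
      (norm_unitPoint Φ x))) (hβ.symm.trans_le ?_)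
    exact antitoneOn_apply_unitPoint Φ hh hα ⟨hx.1, hx.2.trans hβα.le⟩ ⟨hαβ.le, hβα.le⟩ hx.2
  have hsegment {x y : ℝ} (hx : x ∈ Ico α β) (hy : y ∈ Icc x β) : ∃ t : ℝ, 0 ≤ t ∧ t ≤ 1 ∧
      unitPoint Φ y - unitPoint Φ x = t • (unitPoint Φ β - unitPoint Φ x) := by
    obtain ⟨s, t, hs, ht, hst⟩ := exists_unitPoint_eq_smul_add_smul Φ hy.1 hy.2 hx.2
      (by linarith [hx.1])
    have hsum : 1 = s + t := by
      simpa [harc ⟨hx.1, hx.2.le⟩, harc ⟨hx.1.trans hy.1, hy.2⟩, hβ] using congrArg h hst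
    obtain rfl : s = 1 - t := by linarith
    exact ⟨t, ht, by linarith, by rw [hst]; module⟩
  refine ⟨f, monotoneOn_excess Φ fun x hx y hy hxy ↦ ?_,
    antitoneOn_excess Φ fun x _ y _ _ ↦ (le_abs_self _).trans (abs_apply_le_norm hf _)⟩
  rcases hx.2.eq_or_lt with rfl | hxβ
  · simp [le_antisymm hy.2 hxy]
  obtain ⟨t, ht, -, hyx⟩ := hsegment ⟨hx.1, hxβ⟩ ⟨hxy, hy.2⟩
  obtain ⟨s, -, hs, hxα⟩ := hsegment ⟨le_rfl, hαβ⟩ hx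
  have hyx' : unitPoint Φ y - unitPoint Φ x
      = (t * (1 - s)) • (unitPoint Φ β - unitPoint Φ α) := by
    rw [hyx, mul_smul, sub_smul, one_smul, ← hxα, sub_sub_sub_cancel_right]
  rw [hyx', norm_smul, map_smul, hfw, Real.norm_of_nonneg (mul_nonneg ht (sub_nonneg.2 hs)),
    smul_eq_mul, RCLike.ofReal_real_eq_id, id]

theorem exists_isCalibration (hαβ : α < β) (hβα : β < α + Real.pi)
    (hlt : ‖unitPoint Φ β - unitPoint Φ α‖ < 2) : ∃ f, IsCalibration Φ f α β := by
  obtain ⟨h₁, hh₁, hα⟩ := exists_dual_vector'' ℝ (unitPoint Φ α)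
  obtain ⟨h₂, hh₂, hβ⟩ := exists_dual_vector'' ℝ (unitPoint Φ β)
  rw [norm_unitPoint, RCLike.ofReal_one] at hα hβ
  have hp := abs_apply_le_norm hh₁ (unitPoint Φ β)
  have hq := abs_apply_le_norm hh₂ (unitPoint Φ α)
  have hpα := neg_le_of_abs_le (abs_apply_le_norm hh₁ (unitPoint Φ β - unitPoint Φ α))
  rw [map_sub, hα] at hpα
  rw [norm_unitPoint] at hp hq
  rcases (le_of_abs_le hp).eq_or_lt with hp1 | hp1
  · exact exists_isCalibration_of_apply_eq_one Φ hαβ hβα hh₁ hα hp1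
  · refine exists_isCalibration_of_mul_lt_one Φ hαβ hβα hh₁ hh₂ hα hβ ?_
    have hp_lt : |h₁ (unitPoint Φ β)| < 1 := abs_lt.2 ⟨by linarith, hp1⟩
    calc _ ≤ |h₁ (unitPoint Φ β)| * |h₂ (unitPoint Φ α)| := (le_abs_self _).trans_eq (abs_mul _ _)
      _ ≤ |h₁ (unitPoint Φ β)| * 1 := by gcongr
      _ < 1 := by rwa [mul_one]

end Calibration

section ArcVectors

theorem sub_le_sub_of_monotoneOn_of_antitoneOn {G : ℝ → ℝ} {T P α β : ℝ} (hT : 0 < T) (hP : 0 ≤ P)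
    (hG : ∀ s, G (s + T) = G s - P) (hβ : β ∈ Icc α (α + T)) (hmono : MonotoneOn G (Icc α β))
    (hanti : AntitoneOn G (Icc β (α + T))) {x y : ℝ} (hy : y ∈ Icc x (x + T)) :
    G y - G x ≤ G β - G α := by
  have hperiodic : Function.Periodic (fun s ↦ G (s + (y - x)) - G s) T := fun s ↦ by
    simp only [add_right_comm s T, hG]
    ring
  obtain ⟨z, hz, hxz⟩ := hperiodic.exists_mem_Ico hT x α
  simp only [add_sub_cancel] at hxz
  set t := y - x
  have ht : t ∈ Icc 0 T := ⟨sub_nonneg.2 hy.1, sub_le_iff_le_add'.2 hy.2⟩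
  have hmax {s : ℝ} (hs : s ∈ Icc α (α + T)) : G s ≤ G β := by
    rcases le_total s β with h | h
    · exact hmono ⟨hs.1, h⟩ ⟨hβ.1, le_rfl⟩ h
    · exact hanti ⟨le_rfl, hβ.2⟩ ⟨h, hs.2⟩ h
  rw [hxz]
  rcases le_total (z + t) (α + T) with hzt | hzt
  · have hzt_mem : z + t ∈ Icc α (α + T) := ⟨by linarith [hz.1, ht.1], hzt⟩
    rcases le_total z β with hzβ | hzβ
    · linarith [hmax hzt_mem, hmono ⟨le_rfl, hβ.1⟩ ⟨hz.1, hzβ⟩ hz.1]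
    · linarith [hmax ⟨le_rfl, by linarith⟩, hanti ⟨hzβ, hz.2.le⟩
        ⟨hzβ.trans (by linarith [ht.1]), hzt⟩ (by linarith [ht.1])]
  · have hwrap : G (z + t) = G (z + t - T) - P := by rw [← hG, sub_add_cancel]
    have hα : α ≤ z + t - T := by linarith
    have hle : z + t - T ≤ z := by linarith [ht.2]
    rcases le_total z β with hzβ | hzβ
    · linarith [hmax ⟨le_rfl, by linarith⟩, hmono ⟨hα, hle.trans hzβ⟩ ⟨hz.1, hzβ⟩ hle]
    · linarith [hmax ⟨hα, hle.trans hz.2.le⟩, hG α,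
        hanti ⟨hzβ, hz.2.le⟩ ⟨hβ.2, le_rfl⟩ hz.2.le]

theorem convex_of_isClosed_of_forall_separated {E : Type*} [SeminormedAddCommGroup E]
    [NormedSpace ℝ E] {A : Set E} {R : ℝ} (hR : 0 < R) (hclosed : IsClosed A) (h0 : 0 ∈ A)
    (hnorm : ∀ z ∈ A, ‖z‖ ≤ R)
    (hsep : ∀ w ∉ A, ‖w‖ < R → ∃ f : StrongDual ℝ E, ∀ z ∈ A, f z < f w) : Convex ℝ A := by
  refine convexHull_eq_self.1 (Subset.antisymm (fun w hw ↦ ?_) (subset_convexHull ℝ A))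
  have hwR : ‖w‖ ≤ R := mem_closedBall_zero_iff.1 (convexHull_min
    (fun z hz ↦ mem_closedBall_zero_iff.2 (hnorm z hz)) (convex_closedBall 0 R) hw)
  have hscale : MapsTo (fun τ : ℝ ↦ τ • w) (Ico 0 1) A := by
    intro τ hτ
    by_contra hτA
    have hτR : ‖τ • w‖ < R := calc
      ‖τ • w‖ = τ * ‖w‖ := by rw [norm_smul, Real.norm_of_nonneg hτ.1]
      _ ≤ τ * R := mul_le_mul_of_nonneg_left hwR hτ.1
      _ < R := mul_lt_of_lt_one_left hR hτ.2
    obtain ⟨f, hf⟩ := hsep _ hτA hτR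
    have hhull : convexHull ℝ A ⊆ {z | f z < f (τ • w)} :=
      convexHull_min hf (convex_halfSpace_lt f.isLinear _)
    exact lt_irrefl (f (τ • w)) (hhull ((convex_convexHull ℝ A).smul_mem_of_zero_mem
      (subset_convexHull ℝ A h0) hw ⟨hτ.1, hτ.2.le⟩))
  have hlimit := hscale.closure (continuous_id.smul continuous_const)
  rw [closure_Ico zero_ne_one, hclosed.closure_eq] at hlimit
  simpa using hlimit (right_mem_Icc.2 zero_le_one)

variable {E : Type*} [NormedAddCommGroup E] [NormedSpace ℝ E] (Φ : E ≃L[ℝ] ℂ)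

/-- The displacements of the positively oriented arcs of the unit circle of `E` of length at most
`ρ`. The arc from `x` to `x + 2 π` is the full circle, whose displacement is `0`. -/
def arcVectors (ρ : ℝ) : Set E :=
  {w | ∃ x, ∃ y ∈ Icc x (x + 2 * Real.pi), unitPoint Φ y - unitPoint Φ x = w ∧ arcLength Φ x y ≤ ρ}

theorem norm_le_two_of_mem_arcVectors {ρ : ℝ} {w : E} (hw : w ∈ arcVectors Φ ρ) : ‖w‖ ≤ 2 := by
  obtain ⟨x, y, -, rfl, -⟩ := hw
  refine (norm_sub_le _ _).trans_eq ?_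
  rw [norm_unitPoint, norm_unitPoint, one_add_one_eq_two]

theorem zero_mem_arcVectors {ρ : ℝ} (hρ : 0 ≤ ρ) : 0 ∈ arcVectors Φ ρ :=
  ⟨0, 0, by simp [Real.pi_nonneg], sub_self _, by rwa [arcLength_self]⟩

theorem IsCalibration.apply_sub_arcLength_le {f : StrongDual ℝ E} {α β : ℝ}
    (hf : IsCalibration Φ f α β) (hβ : β ∈ Icc α (α + 2 * Real.pi)) {x y : ℝ}
    (hy : y ∈ Icc x (x + 2 * Real.pi)) :
    f (unitPoint Φ y - unitPoint Φ x) - arcLength Φ x y ≤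
      f (unitPoint Φ β - unitPoint Φ α) - arcLength Φ α β := by
  simp only [← excess_sub_excess]
  refine sub_le_sub_of_monotoneOn_of_antitoneOn Real.two_pi_pos
    (arcLength_nonneg Φ Real.two_pi_pos.le) (fun s ↦ ?_) hβ hf.monotoneOn hf.antitoneOn hy
  have hadd := arcLength_add Φ 0 (2 * Real.pi) (s + 2 * Real.pi)
  have hshift := arcLength_add_two_pi Φ 0 s
  rw [zero_add] at hshift
  rw [excess, excess, unitPoint_periodic, ← hadd, hshift]
  ring

theorem exists_forall_mem_arcVectors_lt {ρ : ℝ} (hρ : 0 ≤ ρ) {w : E} (hw : w ∉ arcVectors Φ ρ)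
    (hw2 : ‖w‖ < 2) : ∃ f : StrongDual ℝ E, ∀ z ∈ arcVectors Φ ρ, f z < f w := by
  have hw0 : w ≠ 0 := fun h ↦ hw (h ▸ zero_mem_arcVectors Φ hρ)
  obtain ⟨α, β, hαβ, hβα, rfl⟩ := exists_unitPoint_sub_unitPoint_eq Φ hw0 hw2
  obtain ⟨f, hf⟩ := exists_isCalibration Φ hαβ hβα hw2
  have hβ : β ∈ Icc α (α + 2 * Real.pi) := ⟨hαβ.le, by linarith [Real.pi_pos]⟩
  have hlong : ρ < arcLength Φ α β := not_le.1 fun h ↦ hw ⟨α, β, hβ, rfl, h⟩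
  refine ⟨f, ?_⟩
  rintro _ ⟨x, y, hy, rfl, hshort⟩
  linarith [hf.apply_sub_arcLength_le Φ hβ hy]

theorem isClosed_setOf_mem_arcVectors : IsClosed {p : E × ℝ | p.1 ∈ arcVectors Φ p.2} := by
  let F (p : ℝ × ℝ) : E × ℝ :=
    (unitPoint Φ (p.1 + p.2) - unitPoint Φ p.1, arcLength Φ p.1 (p.1 + p.2))
  have hF : Continuous F := by
    have hadd : Continuous fun p : ℝ × ℝ ↦ p.1 + p.2 := continuous_fst.add continuous_snd
    exact (((continuous_unitPoint Φ).comp hadd).sub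
      ((continuous_unitPoint Φ).comp continuous_fst)).prodMk
      ((continuous_arcLength Φ).comp (continuous_fst.prodMk hadd))
  have hcompact : IsCompact (F '' (Icc 0 (2 * Real.pi) ×ˢ Icc 0 (2 * Real.pi))) :=
    (isCompact_Icc.prod isCompact_Icc).image hF
  have hshift (t : ℝ) : Function.Periodic (fun x ↦ F (x, t)) (2 * Real.pi) := fun x ↦ by
    simp only [F, add_right_comm x, unitPoint_periodic Φ _, arcLength_add_two_pi]
  suffices {p : E × ℝ | p.1 ∈ arcVectors Φ p.2} =
      F '' (Icc 0 (2 * Real.pi) ×ˢ Icc 0 (2 * Real.pi)) + {0} ×ˢ Ici (0 : ℝ) by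
    rw [this]
    exact (isClosed_singleton.prod isClosed_Ici).add_left_of_isCompact hcompact
  ext ⟨w, ρ⟩
  constructor
  · rintro ⟨x, y, hy, rfl, hρ⟩
    obtain ⟨z, hz, hxz⟩ := (hshift (y - x)).exists_mem_Ico Real.two_pi_pos x 0
    rw [zero_add] at hz
    refine ⟨F (z, y - x), mem_image_of_mem F ⟨⟨hz.1, hz.2.le⟩, sub_nonneg.2 hy.1,
      sub_le_iff_le_add'.2 hy.2⟩, (0, ρ - arcLength Φ x y), ⟨rfl, sub_nonneg.2 hρ⟩, ?_⟩
    simp only [← hxz, F, add_sub_cancel, Prod.mk_add_mk, add_zero]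
  · rintro ⟨_, ⟨⟨x, t⟩, ⟨-, ht⟩, rfl⟩, ⟨e, r⟩, ⟨rfl, hr⟩, h⟩
    obtain ⟨rfl, rfl⟩ := Prod.mk.inj h
    exact ⟨x, x + t, ⟨by linarith [ht.1], by linarith [ht.2]⟩, (add_zero _).symm,
      le_add_of_nonneg_right hr⟩

theorem isClosed_arcVectors (ρ : ℝ) : IsClosed (arcVectors Φ ρ) :=
  (isClosed_setOf_mem_arcVectors Φ).preimage (continuous_id.prodMk continuous_const)

theorem mem_arcVectors_of_forall_gt {ρ : ℝ} {w : E} (h : ∀ ρ' > ρ, w ∈ arcVectors Φ ρ') :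
    w ∈ arcVectors Φ ρ := by
  have hclosed : IsClosed {ρ' | w ∈ arcVectors Φ ρ'} :=
    (isClosed_setOf_mem_arcVectors Φ).preimage (continuous_const.prodMk continuous_id)
  have hsubset := hclosed.closure_subset_iff.2 (show Ioi ρ ⊆ _ from h)
  rw [closure_Ioi] at hsubset
  exact hsubset self_mem_Ici

theorem convex_arcVectors {ρ : ℝ} (hρ : 0 ≤ ρ) : Convex ℝ (arcVectors Φ ρ) :=
  convex_of_isClosed_of_forall_separated two_pos (isClosed_arcVectors Φ ρ)
    (zero_mem_arcVectors Φ hρ) (fun _ ↦ norm_le_two_of_mem_arcVectors Φ)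
    fun _ ↦ exists_forall_mem_arcVectors_lt Φ hρ

end ArcVectors

section Lift

theorem lt_add_period_of_injOn_comp {α : Type*} {f : ℝ → α} {T : ℝ} (hf : Function.Periodic f T)
    (hT : 0 < T) {θ : ℝ → ℝ} {S : Set ℝ} (hS : S.OrdConnected) (hθ : ContinuousOn θ S)
    (hinj : InjOn (f ∘ θ) S) {s t : ℝ} (hs : s ∈ S) (ht : t ∈ S) : θ t < θ s + T := by
  by_contra! hlt
  obtain ⟨r, hr, hrs⟩ := intermediate_value_uIcc (hθ.mono (hS.uIcc_subset hs ht))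
    (mem_uIcc_of_le (le_add_of_nonneg_right hT.le) hlt)
  have hr_eq : r = s := hinj (hS.uIcc_subset hs ht hr) hs (by simp only [Function.comp, hrs, hf _])
  rw [hr_eq] at hrs
  linarith

variable {E : Type*} [NormedAddCommGroup E] [NormedSpace ℝ E] (Φ : E ≃L[ℝ] ℂ)

theorem exists_continuous_unitPoint_eq {c : ℝ → E} (hc : Continuous c) (h1 : ∀ t, ‖c t‖ = 1) :
    ∃ θ : ℝ → ℝ, Continuous θ ∧ ∀ t, unitPoint Φ (θ t) = c t := by
  have hne (t : ℝ) : Φ (c t) ≠ 0 :=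
    Φ.map_ne_zero_iff.2 (norm_pos_iff.1 ((h1 t).symm ▸ one_pos))
  have hmem (t : ℝ) : NormedSpace.normalize (Φ (c t)) ∈ Submonoid.unitSphere ℂ :=
    mem_sphere_zero_iff_norm.2 (NormedSpace.norm_normalize (hne t))
  have hcont : Continuous fun t ↦ NormedSpace.normalize (Φ (c t)) :=
    ((Φ.continuous.comp hc).norm.inv₀ fun t ↦ norm_ne_zero_iff.2 (hne t)).smul
      (Φ.continuous.comp hc)
  let g : C(ℝ, Circle) := ⟨fun t ↦ ⟨_, hmem t⟩, hcont.subtype_mk hmem⟩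
  obtain ⟨θ, ⟨-, hθ⟩, -⟩ := Circle.isCoveringMap_exp.existsUnique_continuousMap_lifts g 0
    (Complex.arg (g 0)) (Circle.exp_arg _)
  exact ⟨θ, θ.continuous, fun t ↦
    (unitPoint_eq_iff Φ (h1 t)).2 (congrArg Subtype.val (congrFun hθ t))⟩

theorem exists_continuous_eqOn_unitPoint_comp {c : ℝ → E} {a b : ℝ} (hab : a ≤ b)
    (hc : ContinuousOn c (Icc a b)) (h1 : ∀ t ∈ Icc a b, ‖c t‖ = 1) :
    ∃ θ : ℝ → ℝ, Continuous θ ∧ EqOn (unitPoint Φ ∘ θ) c (Icc a b) := by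
  obtain ⟨θ, hθ, hθc⟩ := exists_continuous_unitPoint_eq Φ
    (c := IccExtend hab ((Icc a b).domRestrict c)) hc.domRestrict.Icc_extend'
    fun t ↦ h1 _ (projIcc a b hab t).2
  exact ⟨θ, hθ, fun t ht ↦ (hθc t).trans (IccExtend_of_mem hab _ ht)⟩

theorem neg_mem_arcVectors {ρ : ℝ} {w : E} (hw : w ∈ arcVectors Φ ρ) : -w ∈ arcVectors Φ ρ := by
  obtain ⟨x, y, hy, rfl, hρ⟩ := hw
  refine ⟨x + Real.pi, y + Real.pi, ⟨by linarith [hy.1], by linarith [hy.2]⟩, ?_, ?_⟩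
  · rw [unitPoint_add_pi, unitPoint_add_pi, neg_sub_neg, neg_sub]
  · rwa [arcLength_add_pi]

theorem sub_mem_arcVectors {c : ℝ → E} {a b ρ : ℝ} (hab : a ≤ b) (hc : ContinuousOn c (Icc a b))
    (hinj : InjOn c (Icc a b)) (h1 : ∀ t ∈ Icc a b, ‖c t‖ = 1) (hρ : 0 ≤ ρ)
    (hlength : eVariationOn c (Icc a b) ≤ ENNReal.ofReal ρ) : c b - c a ∈ arcVectors Φ ρ := by
  obtain ⟨θ, hθ, hθc⟩ := exists_continuous_eqOn_unitPoint_comp Φ hab hc h1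
  have ha : a ∈ Icc a b := left_mem_Icc.2 hab
  have hb : b ∈ Icc a b := right_mem_Icc.2 hab
  have hcomp_inj : InjOn (unitPoint Φ ∘ θ) (Icc a b) := hinj.congr hθc.symm
  have hturn {s t : ℝ} (hs : s ∈ Icc a b) (ht : t ∈ Icc a b) : θ t ≤ θ s + 2 * Real.pi :=
    (lt_add_period_of_injOn_comp (unitPoint_periodic Φ) Real.two_pi_pos ordConnected_Icc
      hθ.continuousOn hcomp_inj hs ht).le
  rw [← eVariationOn.congr hθc] at hlength
  rw [← hθc ha, ← hθc hb]
  rcases hθ.continuousOn.strictMonoOn_of_injOn_Icc' hab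
    (InjOn.of_comp hcomp_inj) with hmono | hanti
  · have hle := hmono.monotoneOn ha hb hab
    refine ⟨θ a, θ b, ⟨hle, hturn ha hb⟩, rfl, ?_⟩
    rwa [eVariationOn.comp_eq_of_monotoneOn _ _ hmono.monotoneOn,
      hθ.continuousOn.image_Icc_of_monotoneOn hab hmono.monotoneOn, ← ofReal_arcLength Φ hle,
      ENNReal.ofReal_le_ofReal_iff hρ] at hlength
  · have hle := hanti.antitoneOn ha hb hab
    rw [← neg_sub]
    refine neg_mem_arcVectors Φ ⟨θ b, θ a, ⟨hle, hturn hb ha⟩, rfl, ?_⟩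
    rwa [eVariationOn.comp_eq_of_antitoneOn _ _ hanti.antitoneOn,
      hθ.continuousOn.image_Icc_of_antitoneOn hab hanti.antitoneOn, ← ofReal_arcLength Φ hle,
      ENNReal.ofReal_le_ofReal_iff hρ] at hlength

theorem exists_injOn_unitPoint_of_mem_arcVectors {ρ : ℝ} {w : E} (hw : w ∈ arcVectors Φ ρ) :
    ∃ x y, x ≤ y ∧ InjOn (unitPoint Φ) (Icc x y) ∧ unitPoint Φ y - unitPoint Φ x = w ∧
      arcLength Φ x y ≤ ρ := by
  obtain ⟨x, y, hy, hdisp, hlength⟩ := hw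
  rcases hy.2.lt_or_eq with hlt | rfl
  · exact ⟨x, y, hy.1, injOn_unitPoint Φ hlt, hdisp, hlength⟩
  · refine ⟨x, x, le_rfl, by simp, ?_, ?_⟩
    · rw [← hdisp, unitPoint_periodic]
    · rw [arcLength_self]
      exact (arcLength_nonneg Φ hy.1).trans hlength

end Lift

section Gauge

universe u

theorem exists_linearEquiv_norm_eq {V : Type u} [AddCommGroup V] [Module ℝ V] (p : Seminorm ℝ V)
    (hp : ∀ x, p x = 0 → x = 0) :
    ∃ (E : Type u) (_ : NormedAddCommGroup E) (_ : NormedSpace ℝ E) (ι : V ≃ₗ[ℝ] E),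
      ∀ x, ‖ι x‖ = p x := by
  let _ : Norm V := ⟨p⟩
  have core : NormedSpace.Core ℝ V :=
    { norm_nonneg := apply_nonneg p
      norm_smul := map_smul_eq_mul p
      norm_triangle := map_add_le_add p
      norm_eq_zero_iff := fun x ↦ ⟨hp x, fun h ↦ h ▸ map_zero p⟩ }
  let _ : NormedAddCommGroup V := NormedAddCommGroup.ofCore core
  exact ⟨V, _, NormedSpace.ofCore core, LinearEquiv.refl ℝ V, fun _ ↦ rfl⟩

theorem exists_continuousLinearEquiv_norm_eq_gauge {V : Type u} [NormedAddCommGroup V]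
    [NormedSpace ℝ V] [FiniteDimensional ℝ V] {C : Set V} (hconv : Convex ℝ C)
    (hbounded : Bornology.IsBounded C) (h0 : C ∈ nhds 0) (hsymm : ∀ x ∈ C, -x ∈ C) :
    ∃ (E : Type u) (_ : NormedAddCommGroup E) (_ : NormedSpace ℝ E) (ι : V ≃L[ℝ] E),
      ∀ x, ‖ι x‖ = gauge C x := by
  have habsorbent := absorbent_nhds_zero (𝕜 := ℝ) h0
  have hbalanced : Balanced ℝ C := (balanced_iff_neg_mem hconv).2 fun x hx ↦ hsymm x hx
  obtain ⟨E, _, _, ι, hι⟩ := exists_linearEquiv_norm_eq (gaugeSeminorm hbalanced hconv habsorbent)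
    fun x ↦ (gauge_eq_zero habsorbent ((NormedSpace.isVonNBounded_iff ℝ).2 hbounded)).1
  have : FiniteDimensional ℝ E := ι.finiteDimensional
  exact ⟨E, _, _, ι.toContinuousLinearEquiv, hι⟩

theorem mem_nhds_zero_of_symm {V : Type*} [AddCommGroup V] [Module ℝ V] [TopologicalSpace V]
    [IsTopologicalAddGroup V] [ContinuousSMul ℝ V] {C : Set V} (hconv : Convex ℝ C)
    (hint : (interior C).Nonempty) (hsymm : ∀ x ∈ C, -x ∈ C) : C ∈ nhds 0 := by
  obtain ⟨x, hx⟩ := hint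
  have hmid := hconv.combo_interior_self_mem_interior hx (hsymm x (interior_subset hx))
    (half_pos one_pos) (half_pos one_pos).le (add_halves 1)
  rwa [smul_neg, add_neg_cancel, mem_interior_iff_mem_nhds] at hmid

theorem mem_frontier_vadd_iff_gauge_sub_eq_one {V : Type*} [AddCommGroup V] [Module ℝ V]
    [TopologicalSpace V] [IsTopologicalAddGroup V] [ContinuousSMul ℝ V] {C : Set V}
    (hconv : Convex ℝ C) (h0 : C ∈ nhds 0) {y p : V} :
    p ∈ frontier (y +ᵥ C) ↔ gauge C (p - y) = 1 := by
  have hfrontier : frontier (y +ᵥ C) = y +ᵥ frontier C :=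
    ((Homeomorph.vadd y).image_frontier C).symm
  rw [hfrontier, gauge_eq_one_iff_mem_frontier hconv h0, mem_vadd_set_iff_neg_vadd_mem,
    vadd_eq_add, neg_add_eq_sub]

variable {E : Type*} [NormedAddCommGroup E] [NormedSpace ℝ E] {C : Set Plane} {ι : Plane ≃L[ℝ] E}

theorem cLength_eq_eVariationOn (hι : ∀ p, ‖ι p‖ = gauge C p) (γ : ℝ → Plane) (a b : ℝ) :
    cLength C γ a b = eVariationOn (ι ∘ γ) (Icc a b) := by
  have hdist (p q : Plane) : ENNReal.ofReal (cDist C p q) = edist (ι q) (ι p) := by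
    rw [edist_dist, dist_eq_norm, ← map_sub, hι, cDist]
  simp only [cLength, eVariationOn, hdist, iSup_prod, iSup_subtype, iSup_and, Function.comp]

theorem cLength_eq_eVariationOn_sub (hι : ∀ p, ‖ι p‖ = gauge C p) (γ : ℝ → Plane) (a b : ℝ)
    (y : Plane) : cLength C γ a b = eVariationOn (fun t ↦ ι (γ t - y)) (Icc a b) := by
  simp only [cLength_eq_eVariationOn hι, eVariationOn, map_sub, edist_sub_right, Function.comp]

variable (Φ : E ≃L[ℝ] ℂ)

theorem IsArcIn.map_sub_mem_arcVectors (hconv : Convex ℝ C) (h0 : C ∈ nhds 0)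
    (hι : ∀ p, ‖ι p‖ = gauge C p) {y p q : Plane} {γ : ℝ → Plane} {a b ρ : ℝ}
    (hγ : IsArcIn (frontier (y +ᵥ C)) γ a b p q) (hρ : 0 ≤ ρ)
    (hlength : cLength C γ a b ≤ ENNReal.ofReal ρ) : ι (q - p) ∈ arcVectors Φ ρ := by
  have hmem := sub_mem_arcVectors Φ (c := fun t ↦ ι (γ t - y)) hγ.le
    (ι.continuous.comp_continuousOn (hγ.continuousOn.sub continuousOn_const))
    (fun s hs t ht hst ↦ hγ.injOn hs ht (sub_left_injective (ι.injective hst)))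
    (fun t ht ↦ by
      rw [hι, ← mem_frontier_vadd_iff_gauge_sub_eq_one hconv h0]
      exact hγ.mapsTo ht)
    hρ (by rwa [← cLength_eq_eVariationOn_sub hι])
  simpa only [← map_sub, sub_sub_sub_cancel_right, hγ.source, hγ.target] using hmem

theorem arcDist_le_of_map_sub_mem_arcVectors (hconv : Convex ℝ C) (h0 : C ∈ nhds 0)
    (hι : ∀ p, ‖ι p‖ = gauge C p) {p q : Plane} {ρ : ℝ} (h : ι (q - p) ∈ arcVectors Φ ρ) :
    arcDist C p q ≤ ENNReal.ofReal ρ := by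
  obtain ⟨a, b, hab, hinj, hdisp, hlength⟩ := exists_injOn_unitPoint_of_mem_arcVectors Φ h
  let y := p - ι.symm (unitPoint Φ a)
  let γ (t : ℝ) := y + ι.symm (unitPoint Φ t)
  have hγ_sub (t : ℝ) : ι (γ t - y) = unitPoint Φ t := by
    rw [add_sub_cancel_left, ι.apply_symm_apply]
  have hγ : IsArcIn (frontier (y +ᵥ C)) γ a b p q :=
    { le := hab
      continuousOn :=
        (continuous_const.add (ι.symm.continuous.comp (continuous_unitPoint Φ))).continuousOn
      injOn := fun s hs t ht hst ↦ hinj hs ht (ι.symm.injective (add_left_cancel hst))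
      source := sub_add_cancel _ _
      target := by
        change p - ι.symm (unitPoint Φ a) + ι.symm (unitPoint Φ b) = q
        rw [sub_add_eq_add_sub, add_sub_assoc, ← map_sub, hdisp, ι.symm_apply_apply,
          add_sub_cancel]
      mapsTo := fun t _ ↦ by
        rw [mem_frontier_vadd_iff_gauge_sub_eq_one hconv h0, ← hι, hγ_sub, norm_unitPoint] }
  calc arcDist C p q ≤ cLength C γ a b := iInf₂_le_of_le y γ (iInf₂_le_of_le a b (iInf_le _ hγ))
    _ = eVariationOn (unitPoint Φ) (Icc a b) := by
      simp only [cLength_eq_eVariationOn_sub hι γ a b y, hγ_sub]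
    _ = ENNReal.ofReal (arcLength Φ a b) := (ofReal_arcLength Φ hab).symm
    _ ≤ ENNReal.ofReal ρ := ENNReal.ofReal_le_ofReal hlength

theorem mem_arcDisk_iff_map_sub_mem_arcVectors (hconv : Convex ℝ C) (h0 : C ∈ nhds 0)
    (hι : ∀ p, ‖ι p‖ = gauge C p) {z w : Plane} {ρ : ℝ} (hρ : 0 ≤ ρ) :
    w ∈ arcDisk C z ρ ↔ ι (w - z) ∈ arcVectors Φ ρ := by
  constructor
  · rintro ⟨-, hdist⟩
    refine mem_arcVectors_of_forall_gt Φ fun ρ' hρ' ↦ ?_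
    have hρ'0 : 0 < ρ' := hρ.trans_lt hρ'
    have hlt := hdist.trans_lt ((ENNReal.ofReal_lt_ofReal_iff hρ'0).2 hρ')
    simp only [arcDist, iInf_lt_iff] at hlt
    obtain ⟨y, γ, a, b, hγ, hlength⟩ := hlt
    exact hγ.map_sub_mem_arcVectors Φ hconv h0 hι hρ'0.le hlength.le
  · intro h
    exact ⟨(hι _).symm.trans_le (norm_le_two_of_mem_arcVectors Φ h),
      arcDist_le_of_map_sub_mem_arcVectors Φ hconv h0 hι h⟩

end Gauge

theorem mainTheorem7_general (C : Set Plane) (hconv : Convex ℝ C)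
    (hbounded : Bornology.IsBounded C) (hint : (interior C).Nonempty) (hsymm : ∀ x ∈ C, -x ∈ C)
    (z : Plane) (ρ : ℝ) (hρ : 0 ≤ ρ) : Convex ℝ (arcDisk C z ρ) := by
  have h0 := mem_nhds_zero_of_symm hconv hint hsymm
  obtain ⟨E, _, _, ι, hι⟩ := exists_continuousLinearEquiv_norm_eq_gauge hconv hbounded h0 hsymm
  let Φ : E ≃L[ℝ] ℂ :=
    ι.symm.trans Complex.orthonormalBasisOneI.repr.symm.toContinuousLinearEquiv
  have hdisk : arcDisk C z ρ = (z + ·) '' (ι ⁻¹' arcVectors Φ ρ) := by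
    ext w
    rw [mem_arcDisk_iff_map_sub_mem_arcVectors Φ hconv h0 hι hρ, image_add_left, mem_preimage,
      mem_preimage, neg_add_eq_sub]
  rw [hdisk]
  exact ((convex_arcVectors Φ hρ).linear_preimage ι.toLinearMap).translate z

theorem mainTheorem7 (C : Set Plane) (hconv : Convex ℝ C) (hcomp : IsCompact C)
    (hint : (interior C).Nonempty) (hsymm : ∀ x ∈ C, -x ∈ C)
    (ρ : ℝ) (hρ0 : 0 ≤ ρ) (hρ : ENNReal.ofReal ρ ≤ perim C C / 2) :
    Convex ℝ (arcDisk C 0 ρ) :=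
  mainTheorem7_general C hconv hcomp.isBounded hint hsymm 0 ρ hρ0
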